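/- Let $(M,d)$ be a complete metric space with Borel $\sigma$-algebra $\mathcal B(M)$. Let $\mathcal P(M)$ be the set of Borel probability measures $\mu$ on $M$ with $\mu(\operatorname{supp}\mu)=1$ (automatic if $M$ is separable), and define $\mathcal P(M\times M)$ likewise with respect to the Borel $\sigma$-algebra of $M\times M$. For $1\le p<\infty$ let $\mathcal P^p(M)$ be the set of $\mu\in\mathcal P(M)$ with $\int_M d(x,y)^p\,d\mu(y)<\infty$ for some $x\in M$, equipped with the $p$-Wasserstein distance $$d_p^W(\mu,\nu)=\Bigl[\inf_{\pi\in\Pi(\mu,\nu)}\int_{M\times M}d(x,y)^p\,d\pi(x,y)\Bigr]^{1/p},$$ where $\Pi(\mu,\nu)$ is the set of $\pi\in\mathcal P(M\times M)$ with marginals $\mu$ and $\nu$; let $\mathcal P^\infty(M)\subset\mathcal P^p(M)$ be the set of $\mu\in\mathcal P(M)$ with bounded support. Let $1\le p<\infty$ and let $\beta:\mathcal P^p(M)\to M$ be a $p$-contractive barycentric map, that is, $\beta(\delta_x)=x$ for all $x\in M$ and $d(\beta(\mu),\beta(\nu))\le d_p^W(\mu,\nu)$ for all $\mu,\nu\in\mathcal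 P^p(M)$. Let $X_1,X_2,\dots$ be i.i.d. $M$-valued random variables (Borel measurable maps) on a probability space $(\Omega,\mathcal A,\mathbf P)$ whose common distribution $\mu_0$ belongs to $\mathcal P^\infty(M)$. Then, for $\mathbf P$-almost every $\omega\in\Omega$, $$\beta\Bigl(\frac1n\sum_{i=1}^n\delta_{X_i(\omega)}\Bigr)\longrightarrow\beta(\mu_0)\qquad\text{in }(M,d)\text{ as }n\to\infty.$$ -/

import Mathlib

open MeasureTheory ProbabilityTheory Filter Topology
open scoped ENNReal

namespace Barycentric

/-- Probability measures that are concentrated on their support, i.e. `μ (supp μ) = 1`. On a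
non-separable metric space this is a restriction; it amounts to having separable support. -/
structure IsFullySupported {X : Type*} [TopologicalSpace X] {m : MeasurableSpace X}
    (μ : Measure X) : Prop where
  prob : IsProbabilityMeasure μ
  full : μ μ.support = 1

/-- The set of Borel probability measures with full support and finite `p`-th moment. -/
structure IsPth {M : Type*} [MetricSpace M] [MeasurableSpace M] (p : ℝ) (μ : Measure M) :
    Prop where
  fullySupported : IsFullySupported μ
  moment : ∃ x : M, ∫⁻ y, edist x y ^ p ∂μ < ∞

/-- The set of Borel probability measures with full and bounded support. -/
structure IsBdd {M : Type*} [MetricSpace M] [MeasurableSpace M] (μ : Measure M) : Prop where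
  fullySupported : IsFullySupported μ
  bounded : ∃ (x : M) (α : ℝ), μ.support ⊆ Metric.closedBall x α

/-- The space `𝒫ᵖ(M)`. -/
def Pp (p : ℝ) (M : Type*) [MetricSpace M] [MeasurableSpace M] : Type _ :=
  {μ : Measure M // IsPth p μ}

/-- Couplings of `μ` and `ν`. They live on the Borel σ-algebra of `M × M`, which for a
non-separable `M` may be larger than the product σ-algebra. -/
structure IsCoupling {M : Type*} [MetricSpace M] [MeasurableSpace M]
    (π : @Measure (M × M) (borel (M × M))) (μ ν : Measure M) : Prop where
  fullySupported : IsFullySupported π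
  fst : ∀ B : Set M, MeasurableSet B → π (B ×ˢ Set.univ) = μ B
  snd : ∀ B : Set M, MeasurableSet B → π (Set.univ ×ˢ B) = ν B

/-- The `p`-Wasserstein distance, with values in `[0, ∞]`. -/
noncomputable def wasserstein {M : Type*} [MetricSpace M] [MeasurableSpace M] (p : ℝ)
    (μ ν : Measure M) : ℝ≥0∞ :=
  (⨅ π : {π : @Measure (M × M) (borel (M × M)) // IsCoupling π μ ν},
    ∫⁻ z, edist z.1 z.2 ^ p ∂π.1) ^ (1 / p)

section Membership

variable {M : Type*} [MetricSpace M] [MeasurableSpace M] [BorelSpace M]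

lemma IsFullySupported.measure_compl_support {μ : Measure M} (h : IsFullySupported μ) :
    μ μ.supportᶜ = 0 := by
  have := h.prob
  exact (prob_compl_eq_zero_iff Measure.isClosed_support.measurableSet).2 h.full

lemma IsBdd.isPth {p : ℝ} (hp : 1 ≤ p) {μ : Measure M} (h : IsBdd μ) : IsPth p μ := by
  refine ⟨h.fullySupported, ?_⟩
  obtain ⟨x, α, hα⟩ := h.bounded
  have := h.fullySupported.prob
  refine ⟨x, ?_⟩
  have hae : ∀ᵐ y ∂μ, edist x y ^ p ≤ ENNReal.ofReal α ^ p := by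
    have h0 : ∀ᵐ y ∂μ, y ∈ μ.support := h.fullySupported.measure_compl_support
    filter_upwards [h0] with y hy
    refine ENNReal.rpow_le_rpow ?_ (by linarith)
    rw [edist_dist, dist_comm]
    exact ENNReal.ofReal_le_ofReal (hα hy)
  calc ∫⁻ y, edist x y ^ p ∂μ ≤ ∫⁻ _, ENNReal.ofReal α ^ p ∂μ := lintegral_mono_ae hae
    _ = ENNReal.ofReal α ^ p := by simp
    _ < ∞ := ENNReal.rpow_lt_top_of_nonneg (by linarith) ENNReal.ofReal_ne_top

/-- A probability measure carried by a finite set has full and bounded support. -/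
lemma isBdd_of_finite {μ : Measure M} [IsProbabilityMeasure μ] {s : Set M} (hs : s.Finite)
    (hμ : μ sᶜ = 0) : IsBdd μ := by
  have hsub : μ.support ⊆ s := Measure.support_subset_of_isClosed hs.isClosed hμ
  have hnull : μ μ.supportᶜ = 0 := by
    have h1 : μ (s \ μ.support) = 0 := by
      refine (measure_null_iff_singleton (hs.countable.mono Set.sdiff_subset)).2 ?_
      intro x hx
      obtain ⟨U, hU, hU0⟩ := Measure.notMem_support_iff_exists.1 hx.2
      exact measure_mono_null (Set.singleton_subset_iff.2 (mem_of_mem_nhds hU)) hU0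
    refine measure_mono_null (t := s \ μ.support ∪ sᶜ) ?_ (measure_union_null h1 hμ)
    intro x hx
    by_cases hxs : x ∈ s
    · exact Or.inl ⟨hxs, hx⟩
    · exact Or.inr hxs
  refine ⟨⟨inferInstance,
    (prob_compl_eq_zero_iff Measure.isClosed_support.measurableSet).1 hnull⟩, ?_⟩
  obtain ⟨x⟩ : Nonempty M := nonempty_of_isProbabilityMeasure μ
  obtain ⟨α, hα⟩ := hs.isBounded.subset_closedBall x
  exact ⟨x, α, hsub.trans hα⟩

lemma isBdd_dirac (x : M) : IsBdd (Measure.dirac x) :=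
  isBdd_of_finite (Set.finite_singleton x)
    (by rw [Measure.dirac_apply' _ (measurableSet_singleton x).compl]; simp)

/-- The point mass `δ_x` as an element of `𝒫ᵖ(M)`. -/
noncomputable def pointMass {p : ℝ} (hp : 1 ≤ p) (x : M) : Pp p M :=
  ⟨Measure.dirac x, (isBdd_dirac x).isPth hp⟩

/-- The uniform measure `n⁻¹ ∑_{i < n} δ_{x i}` on the first `n` terms of a sequence. -/
noncomputable def empiricalMeasure (n : ℕ) (x : ℕ → M) : Measure M :=
  (n : ℝ≥0∞)⁻¹ • ∑ i ∈ Finset.range n, Measure.dirac (x i)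

lemma isBdd_empiricalMeasure {n : ℕ} (hn : 0 < n) (x : ℕ → M) :
    IsBdd (empiricalMeasure n x) := by
  have : IsProbabilityMeasure (empiricalMeasure n x) := ⟨by
    simp only [empiricalMeasure, Measure.smul_apply, Measure.finsetSum_apply, measure_univ,
      Finset.sum_const, Finset.card_range, nsmul_eq_mul, mul_one, smul_eq_mul]
    exact ENNReal.inv_mul_cancel (by exact_mod_cast hn.ne') (ENNReal.natCast_ne_top n)⟩
  have hs : (x '' (Finset.range n : Set ℕ)).Finite := (Finset.finite_toSet _).image x
  refine isBdd_of_finite hs ?_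
  simp only [empiricalMeasure, Measure.smul_apply, Measure.finsetSum_apply, smul_eq_mul]
  rw [Finset.sum_eq_zero, mul_zero]
  intro i hi
  rw [Measure.dirac_apply' _ hs.measurableSet.compl]
  simp only [Set.indicator_apply_eq_zero, Set.mem_compl_iff]
  exact fun h => (h ⟨i, hi, rfl⟩).elim

/-- The empirical measure of `x 0, …, x (n - 1)` as an element of `𝒫ᵖ(M)`, for `n ≥ 1`. -/
noncomputable def empirical {p : ℝ} (hp : 1 ≤ p) {n : ℕ} (hn : 0 < n) (x : ℕ → M) : Pp p M :=
  ⟨empiricalMeasure n x, (isBdd_empiricalMeasure hn x).isPth hp⟩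

/-- `p`-contractive barycentric maps `β : 𝒫ᵖ(M) → M`. -/
structure IsContractiveBarycentric {p : ℝ} (hp : 1 ≤ p) (β : Pp p M → M) : Prop where
  pointMass : ∀ x : M, β (pointMass hp x) = x
  contractive : ∀ μ ν : Pp p M, edist (β μ) (β ν) ≤ wasserstein p μ.1 ν.1

end Membership

end Barycentric

/-! ### Separable supports and pushforward couplings -/

namespace Barycentric

/-! Since `β` is 1-Lipschitz for the Wasserstein distance, the empirical measures only have to
approach `μ₀`. Both are compared with their images under a simple function `T` that is close to the
identity in the `p`-th mean of `μ₀` (`edist_le`). The two discretization costs are integrals of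
`edist x (T x) ^ p`; by the strong law, the empirical one converges to the one for `μ₀`. The two
images live on the same finite set, so the cost between them is at most the mass not shared times a
power of the diameter (`wasserstein_sum_dirac_le`), and the strong law on the fibres of `T` sends it
to 0. Couplings must be concentrated on their supports; separability of the support of a finite
measure ensures this without assuming `M` separable. -/

/-- In a metric space, the support of a finite measure is separable. -/
lemma isSeparable_support {X : Type*} [PseudoEMetricSpace X] [MeasurableSpace X]
    [OpensMeasurableSpace X] (μ : Measure X) [IsFiniteMeasure μ] :
    TopologicalSpace.IsSeparable μ.support := by
  obtain ⟨t, -, htc, ht⟩ := EMetric.subset_countable_closure_of_almost_dense_set μ.support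
    (fun ε hε => by
      obtain ⟨δ, hδ0, hδε⟩ := ENNReal.lt_iff_exists_nnreal_btwn.1 hε
      have hδ0' : (0 : ℝ≥0∞) < δ := hδ0
      -- A maximal `δ`-separated subset of the support is a `δ`-net. The balls of radius `δ / 2`
      -- about its points are disjoint and of positive mass, so it is countable.
      obtain ⟨N, -, hN⟩ := zorn_subset_nonempty
        {N : Set X | N ⊆ μ.support ∧ Metric.IsSeparated (δ : ℝ≥0∞) N}
        (fun c hc hchain _ => ⟨⋃₀ c, ⟨Set.sUnion_subset fun s hs => (hc hs).1,
          (Set.pairwise_sUnion hchain.directedOn).2 fun s hs => (hc hs).2⟩,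
          fun s hs => Set.subset_sUnion_of_mem hs⟩)
        ∅ ⟨Set.empty_subset _, Metric.IsSeparated.empty⟩
      have hcov := Metric.IsCover.of_maximal_isSeparated hN
      refine ⟨N, ?_, (Metric.isCover_iff_subset_iUnion_closedEBall.1 hcov).trans
        (Set.iUnion₂_mono fun x _ => Metric.closedEBall_subset_closedEBall hδε.le)⟩
      have hdisj : Pairwise (Function.onFun Disjoint
          (fun x : N => Metric.eball (x : X) ((δ : ℝ≥0∞) / 2))) := by
        intro x y hxy
        have h := hN.prop.2 x.2 y.2 (fun h => hxy (Subtype.ext h))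
        refine Metric.eball_disjoint ?_
        rw [ENNReal.add_halves]
        exact h.le
      have hc := Measure.countable_meas_pos_of_disjoint_iUnion (μ := μ)
        (fun x : N => (Metric.isOpen_eball (x := (x : X))).measurableSet) hdisj
      have huniv : {x : N | 0 < μ (Metric.eball (x : X) ((δ : ℝ≥0∞) / 2))} = Set.univ := by
        refine Set.eq_univ_of_forall fun x => ?_
        exact (Measure.mem_support_iff_forall _).1 (hN.prop.1 x.2) _
          (Metric.eball_mem_nhds _ (ENNReal.half_pos hδ0'.ne'))
      rw [huniv] at hc
      exact Set.countable_coe_iff.1 (Set.countable_univ_iff.1 hc))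
  exact ⟨t, htc, ht⟩

/-- A probability measure carried by a separable set is concentrated on its support. -/
lemma isFullySupported_of_isSeparable {X : Type*} [TopologicalSpace X]
    [TopologicalSpace.PseudoMetrizableSpace X] [MeasurableSpace X] [OpensMeasurableSpace X]
    (μ : Measure X) [IsProbabilityMeasure μ] {S : Set X} (hS : TopologicalSpace.IsSeparable S)
    (hμ : ∀ᵐ x ∂μ, x ∈ S) : IsFullySupported μ := by
  have := (hS.mono (Set.inter_subset_left (t := μ.supportᶜ))).secondCountableTopology
  -- Points off the support have null neighbourhoods, and by the Lindelöf property countably many of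
  -- them cover.
  have hL : IsLindelof (S ∩ μ.supportᶜ) :=
    isLindelof_iff_isLindelof_univ.2 isLindelof_univ
  have h1 : μ (S ∩ μ.supportᶜ) = 0 := by
    have : (S ∩ μ.supportᶜ)ᶜ ∈ ae μ := by
      refine hL.compl_mem_sets_of_nhdsWithin fun x hx => ?_
      obtain ⟨U, hU, hU0⟩ := Measure.notMem_support_iff_exists.1 hx.2
      exact ⟨U, mem_nhdsWithin_of_mem_nhds hU, by rwa [mem_ae_iff, compl_compl]⟩
    rwa [mem_ae_iff, compl_compl] at this
  refine ⟨inferInstance, (prob_compl_eq_zero_iff Measure.isClosed_support.measurableSet).1 ?_⟩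
  refine measure_mono_null (fun x hx => ?_) (measure_union_null h1 hμ)
  by_cases hxS : x ∈ S
  · exact Or.inl ⟨hxS, hx⟩
  · exact Or.inr hxS

/-- The joint law of an essentially separably valued pair `(f, g)` bounds the Wasserstein distance
of its marginals. -/
lemma wasserstein_map_le {M : Type*} [MetricSpace M] [MeasurableSpace M] [BorelSpace M]
    {α : Type*} [MeasurableSpace α] (ρ : Measure α) [IsProbabilityMeasure ρ] {p : ℝ} (hp : 1 ≤ p)
    {f g : α → M} (hfg : Measurable[_, borel (M × M)] fun a => (f a, g a)) {S : Set (M × M)}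
    (hS : TopologicalSpace.IsSeparable S) (hmem : ∀ᵐ a ∂ρ, (f a, g a) ∈ S) :
    wasserstein p (ρ.map f) (ρ.map g) ≤ (∫⁻ a, edist (f a) (g a) ^ p ∂ρ) ^ (1 / p) := by
  let _ : MeasurableSpace (M × M) := borel (M × M)
  have _ : BorelSpace (M × M) := ⟨rfl⟩
  have hf : Measurable f := continuous_fst.measurable.comp hfg
  have hg : Measurable g := continuous_snd.measurable.comp hfg
  have hprob : IsProbabilityMeasure (ρ.map fun a => (f a, g a)) :=
    Measure.isProbabilityMeasure_map hfg.aemeasurable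
  have hfull : IsFullySupported (ρ.map fun a => (f a, g a)) := by
    -- `S` need not be measurable; its closure is, and stays separable.
    refine isFullySupported_of_isSeparable _ hS.closure ?_
    exact (ae_map_iff (p := fun z => z ∈ closure S) hfg.aemeasurable
      isClosed_closure.measurableSet).2 (hmem.mono fun a ha => subset_closure ha)
  have hcoup : IsCoupling (ρ.map fun a => (f a, g a)) (ρ.map f) (ρ.map g) := by
    refine ⟨hfull, fun B hB => ?_, fun B hB => ?_⟩
    · have hB' : MeasurableSet (B ×ˢ (Set.univ : Set M)) := by
        rw [Set.prod_univ]; exact continuous_fst.measurable hB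
      rw [Measure.map_apply hfg hB', Measure.map_apply hf hB]
      congr 1; ext; simp
    · have hB' : MeasurableSet ((Set.univ : Set M) ×ˢ B) := by
        rw [Set.univ_prod]; exact continuous_snd.measurable hB
      rw [Measure.map_apply hfg hB', Measure.map_apply hg hB]
      congr 1; ext; simp
  have hcost : Measurable fun z : M × M => edist z.1 z.2 ^ p :=
    (continuous_edist.measurable).pow_const p
  refine ENNReal.rpow_le_rpow (iInf_le_of_le ⟨_, hcoup⟩ ?_) (by positivity)
  rw [lintegral_map hcost hfg]

/-- Moving the mass of a measure along a simple function. -/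
lemma wasserstein_map_simpleFunc_le {M : Type*} [MetricSpace M] [MeasurableSpace M] [BorelSpace M]
    {μ : Measure M} (hμ : IsFullySupported μ) {p : ℝ} (hp : 1 ≤ p) (T : SimpleFunc M M) :
    wasserstein p μ (μ.map T) ≤ (∫⁻ x, edist x (T x) ^ p ∂μ) ^ (1 / p) := by
  have := hμ.prob
  have hmeas : Measurable[_, borel (M × M)] fun x => (x, T x) := by
    let _ : MeasurableSpace (M × M) := borel (M × M)
    have _ : BorelSpace (M × M) := ⟨rfl⟩
    -- Measurable coordinates would not suffice for the Borel σ-algebra of `M × M`; but on each of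
    -- the finitely many fibres of `T` the map is a continuous `x ↦ (x, b)`.
    exact T.measurable_bind (fun b x => (x, b)) fun b => (by fun_prop : Continuous _).measurable
  have h := wasserstein_map_le μ hp (f := fun x => x) (g := T) hmeas
    ((isSeparable_support μ).prod (T.finite_range.countable.isSeparable))
    ((show ∀ᵐ x ∂μ, x ∈ μ.support from hμ.measure_compl_support).mono
      fun x hx => ⟨hx, Set.mem_range_self x⟩)
  rwa [Measure.map_id'] at h

end Barycentric

/-! ### Transport between measures on a common finite set -/

namespace Barycentric

/-- Two measures with weights `a` and `b` on the same finitely many points: leave the common part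
`min a b` in place and redistribute the rest. -/
lemma wasserstein_sum_dirac_le {M : Type*} [MetricSpace M] [MeasurableSpace M] [BorelSpace M]
    {p : ℝ} (hp : 1 ≤ p) {ι : Type*} [Fintype ι] (v : ι → M) {a b : ι → ℝ} (ha : ∀ i, 0 ≤ a i)
    (hb : ∀ i, 0 ≤ b i) (ha1 : ∑ i, a i = 1) (hb1 : ∑ i, b i = 1) {D : ℝ≥0∞}
    (hD : ∀ i j, edist (v i) (v j) ≤ D) :
    wasserstein p (∑ i, ENNReal.ofReal (a i) • Measure.dirac (v i))
      (∑ i, ENNReal.ofReal (b i) • Measure.dirac (v i)) ≤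
      (ENNReal.ofReal (1 - ∑ i, min (a i) (b i)) * D ^ p) ^ (1 / p) := by
  classical
  let _ : MeasurableSpace (ι × ι) := ⊤
  have : DiscreteMeasurableSpace (ι × ι) := ⟨fun _ => trivial⟩
  set c : ι → ℝ := fun i => min (a i) (b i) with hc
  set r : ℝ := 1 - ∑ i, c i with hr
  have hca : ∀ i, 0 ≤ a i - c i := fun i => sub_nonneg.2 (min_le_left _ _)
  have hcb : ∀ i, 0 ≤ b i - c i := fun i => sub_nonneg.2 (min_le_right _ _)
  have hc0 : ∀ i, 0 ≤ c i := fun i => le_min (ha i) (hb i)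
  have hra : ∑ i, (a i - c i) = r := by rw [Finset.sum_sub_distrib, ha1]
  have hrb : ∑ i, (b i - c i) = r := by rw [Finset.sum_sub_distrib, hb1]
  have hr0 : 0 ≤ r := hra ▸ Finset.sum_nonneg fun i _ => hca i
  -- Normalized product of the excesses. If `r = 0`, all excesses vanish, and division by zero gives
  -- the right value 0.
  set e : ι → ι → ℝ := fun i j => (a i - c i) * (b j - c j) / r with he
  have he0 : ∀ i j, 0 ≤ e i j := fun i j => div_nonneg (mul_nonneg (hca i) (hcb j)) hr0
  have hea : ∀ i, ∑ j, e i j = a i - c i := fun i => by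
    simp only [he]
    rw [← Finset.sum_div, ← Finset.mul_sum, hrb]
    by_cases h : r = 0
    · rw [h] at hra
      simp [h, (Finset.sum_eq_zero_iff_of_nonneg fun i _ => hca i).1 hra i (Finset.mem_univ i)]
    · field_simp
  have heb : ∀ j, ∑ i, e i j = b j - c j := fun j => by
    simp only [he]
    rw [← Finset.sum_div, ← Finset.sum_mul, hra]
    by_cases h : r = 0
    · rw [h] at hrb
      simp [h, (Finset.sum_eq_zero_iff_of_nonneg fun i _ => hcb i).1 hrb j (Finset.mem_univ j)]
    · field_simp
  set w : ι → ι → ℝ := fun i j => (if i = j then c i else 0) + e i j with hw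
  have hw0 : ∀ i j, 0 ≤ w i j := fun i j =>
    add_nonneg (by split_ifs; exacts [hc0 i, le_rfl]) (he0 i j)
  have hwa : ∀ i, ∑ j, w i j = a i := fun i => by simp [hw, Finset.sum_add_distrib, hea]
  have hwb : ∀ j, ∑ i, w i j = b j := fun j => by simp [hw, Finset.sum_add_distrib, heb]
  set ρ : Measure (ι × ι) := ∑ i, ∑ j, ENNReal.ofReal (w i j) • Measure.dirac (i, j) with hρ
  have hmap : ∀ f : ι × ι → M, ρ.map f =
      ∑ i, ∑ j, ENNReal.ofReal (w i j) • Measure.dirac (f (i, j)) := fun f => by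
    ext B hB
    have hf : Measurable f := Measurable.of_discrete
    rw [Measure.map_apply hf hB]
    simp [hρ, Measure.finsetSum_apply, Measure.dirac_apply' _ hB, Set.indicator_apply]
  have hfst : ρ.map (fun z => v z.1) = ∑ i, ENNReal.ofReal (a i) • Measure.dirac (v i) := by
    rw [hmap]
    refine Finset.sum_congr rfl fun i _ => ?_
    dsimp only
    rw [← Finset.sum_smul, ← ENNReal.ofReal_sum_of_nonneg fun j _ => hw0 i j, hwa]
  have hsnd : ρ.map (fun z => v z.2) = ∑ i, ENNReal.ofReal (b i) • Measure.dirac (v i) := by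
    rw [hmap, Finset.sum_comm]
    refine Finset.sum_congr rfl fun j _ => ?_
    dsimp only
    rw [← Finset.sum_smul, ← ENNReal.ofReal_sum_of_nonneg fun i _ => hw0 i j, hwb]
  have hprob : IsProbabilityMeasure ρ := ⟨by
    simp only [hρ, Measure.finsetSum_apply, Measure.smul_apply, measure_univ, smul_eq_mul, mul_one]
    simp_rw [← ENNReal.ofReal_sum_of_nonneg fun j _ => hw0 _ j, hwa]
    rw [← ENNReal.ofReal_sum_of_nonneg fun i _ => ha i, ha1, ENNReal.ofReal_one]⟩
  have hle := wasserstein_map_le ρ hp (f := fun z => v z.1) (g := fun z => v z.2)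
    (by let _ : MeasurableSpace (M × M) := borel (M × M); exact Measurable.of_discrete)
    (Set.finite_range fun z : ι × ι => (v z.1, v z.2)).countable.isSeparable
    (Eventually.of_forall fun z => Set.mem_range_self z)
  rw [hfst, hsnd] at hle
  refine hle.trans (ENNReal.rpow_le_rpow ?_ (by positivity))
  have hcost : ∫⁻ z, edist (v z.1) (v z.2) ^ p ∂ρ =
      ∑ i, ∑ j, ENNReal.ofReal (w i j) * edist (v i) (v j) ^ p := by
    simp [hρ]
  rw [hcost]
  calc ∑ i, ∑ j, ENNReal.ofReal (w i j) * edist (v i) (v j) ^ p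
      ≤ ∑ i, ∑ j, ENNReal.ofReal (e i j) * D ^ p := by
        refine Finset.sum_le_sum fun i _ => Finset.sum_le_sum fun j _ => ?_
        by_cases hij : i = j
        · simp [hij, ENNReal.zero_rpow_of_pos (by linarith : 0 < p)]
        · simp only [hw, if_neg hij, zero_add]
          gcongr
          exact hD i j
    _ = ENNReal.ofReal r * D ^ p := by
        simp_rw [← Finset.sum_mul, ← ENNReal.ofReal_sum_of_nonneg fun j _ => he0 _ j, hea]
        rw [← ENNReal.ofReal_sum_of_nonneg fun i _ => hca i, hra]

/-- The image of a probability measure under a simple function is finitely supported. -/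
lemma map_simpleFunc_eq_sum {α M : Type*} [MeasurableSpace α] [MeasurableSpace M]
    (μ : Measure α) [IsProbabilityMeasure μ] (T : SimpleFunc α M) (hT : Measurable T) :
    μ.map T = ∑ y : T.range, ENNReal.ofReal (μ.real (T ⁻¹' {(y : M)})) • Measure.dirac (y : M) := by
  classical
  ext B hB
  rw [Measure.map_apply hT hB, Measure.finsetSum_apply]
  have h1 : T ⁻¹' B = T ⁻¹' ((T.range.filter (· ∈ B) : Finset M) : Set M) := by
    ext x; simp
  rw [h1, ← T.sum_measure_preimage_singleton, Finset.sum_filter, ← Finset.sum_coe_sort]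
  refine Finset.sum_congr rfl fun y _ => ?_
  simp [Measure.dirac_apply' _ hB, Set.indicator_apply]

lemma sum_range_measureReal_preimage {α M : Type*} [MeasurableSpace α]
    (μ : Measure α) [IsProbabilityMeasure μ] (T : SimpleFunc α M) :
    ∑ y : T.range, μ.real (T ⁻¹' {(y : M)}) = 1 := by
  rw [Finset.sum_coe_sort T.range fun y => μ.real (T ⁻¹' {y})]
  simp only [measureReal_def]
  rw [← ENNReal.toReal_sum fun _ _ => measure_ne_top _ _, T.sum_range_measure_preimage_singleton,
    measure_univ, ENNReal.toReal_one]

/-- Both images are carried by `T.range`, with the fibre masses as weights, so only mass not shared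
fibre by fibre has to move. -/
lemma wasserstein_map_map_simpleFunc_le {M : Type*} [MetricSpace M] [MeasurableSpace M]
    [BorelSpace M] {p : ℝ} (hp : 1 ≤ p) (μ ν : Measure M) [IsProbabilityMeasure μ]
    [IsProbabilityMeasure ν] (T : SimpleFunc M M) {D : ℝ≥0∞}
    (hD : ∀ x y, edist (T x) (T y) ≤ D) :
    wasserstein p (μ.map T) (ν.map T) ≤
      (ENNReal.ofReal (1 - ∑ y : T.range,
        min (μ.real (T ⁻¹' {(y : M)})) (ν.real (T ⁻¹' {(y : M)}))) * D ^ p) ^ (1 / p) := by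
  rw [map_simpleFunc_eq_sum μ T T.measurable, map_simpleFunc_eq_sum ν T T.measurable]
  refine wasserstein_sum_dirac_le hp _ (fun _ => measureReal_nonneg) (fun _ => measureReal_nonneg)
    (sum_range_measureReal_preimage μ T) (sum_range_measureReal_preimage ν T) ?_
  rintro ⟨y, hy⟩ ⟨z, hz⟩
  obtain ⟨x, rfl⟩ := SimpleFunc.mem_range.1 hy
  obtain ⟨x', rfl⟩ := SimpleFunc.mem_range.1 hz
  exact hD x x'

end Barycentric

/-! ### Discretization and the law of large numbers -/

namespace Barycentric

variable {M : Type*} [MetricSpace M] [MeasurableSpace M] [BorelSpace M]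

lemma isBdd_map_simpleFunc (μ : Measure M) [IsProbabilityMeasure μ] (T : SimpleFunc M M) :
    IsBdd (μ.map T) := by
  have := Measure.isProbabilityMeasure_map (μ := μ) T.measurable.aemeasurable
  refine isBdd_of_finite T.finite_range ?_
  rw [Measure.map_apply T.measurable T.finite_range.measurableSet.compl]
  simp

/-- A contractive barycentric map separates two measures by at most the cost of discretizing both
along a simple function, plus the cost of transport between the discretizations. -/
lemma IsContractiveBarycentric.edist_le {p : ℝ} {hp : 1 ≤ p} {β : Pp p M → M}
    (hβ : IsContractiveBarycentric hp β) (μ ν : Pp p M) (T : SimpleFunc M M) :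
    edist (β μ) (β ν) ≤ (∫⁻ x, edist x (T x) ^ p ∂μ.1) ^ (1 / p) +
      (ENNReal.ofReal (1 - ∑ y : T.range,
        min (μ.1.real (T ⁻¹' {(y : M)})) (ν.1.real (T ⁻¹' {(y : M)}))) *
          Metric.ediam (Set.range T) ^ p) ^ (1 / p) +
      (∫⁻ x, edist x (T x) ^ p ∂ν.1) ^ (1 / p) := by
  have hμ := μ.2.fullySupported.prob
  have hν := ν.2.fullySupported.prob
  let μ' : Pp p M := ⟨μ.1.map T, (isBdd_map_simpleFunc μ.1 T).isPth hp⟩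
  let ν' : Pp p M := ⟨ν.1.map T, (isBdd_map_simpleFunc ν.1 T).isPth hp⟩
  refine (edist_triangle4 _ (β μ') (β ν') _).trans (add_le_add (add_le_add ?_ ?_) ?_)
  · exact (hβ.contractive μ μ').trans (wasserstein_map_simpleFunc_le μ.2.fullySupported hp T)
  · exact (hβ.contractive μ' ν').trans (wasserstein_map_map_simpleFunc_le hp μ.1 ν.1 T
      fun x y => Metric.edist_le_ediam_of_mem (Set.mem_range_self x) (Set.mem_range_self y))
  · rw [edist_comm]
    exact (hβ.contractive ν ν').trans (wasserstein_map_simpleFunc_le ν.2.fullySupported hp T)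

/-- Simple functions approximate the identity in the `p`-th mean. -/
lemma IsPth.exists_simpleFunc {p : ℝ} (hp : 1 ≤ p) {μ : Measure M} (hμ : IsPth p μ) :
    ∃ T : ℕ → SimpleFunc M M, (∀ m, ∫⁻ x, edist x (T m x) ^ p ∂μ ≠ ∞) ∧
      Tendsto (fun m => ∫⁻ x, edist x (T m x) ^ p ∂μ) atTop (𝓝 0) := by
  have := hμ.fullySupported.prob
  have hp0 : 0 < p := by linarith
  obtain ⟨x₀, hx₀⟩ := hμ.moment
  -- With `x₀` as base point, `approxOn` never does worse than the constant `x₀`, whose cost is the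
  -- finite moment; this is the dominating function.
  have hsep : TopologicalSpace.IsSeparable ({x₀} ∪ μ.support) :=
    (Set.countable_singleton x₀).isSeparable.union (isSeparable_support μ)
  have := hsep.separableSpace
  have h₀ : x₀ ∈ {x₀} ∪ μ.support := Or.inl rfl
  let T := SimpleFunc.approxOn (fun x : M => x) measurable_id _ x₀ h₀
  have hle : ∀ m x, edist x (T m x) ^ p ≤ edist x₀ x ^ p := fun m x => by
    rw [edist_comm x]
    exact ENNReal.rpow_le_rpow (SimpleFunc.edist_approxOn_le measurable_id h₀ x m) hp0.le
  refine ⟨T, fun m => ((lintegral_mono (hle m)).trans_lt hx₀).ne, ?_⟩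
  have hlim : ∀ᵐ x ∂μ, Tendsto (fun m => edist x (T m x) ^ p) atTop (𝓝 0) := by
    have h0 : ∀ᵐ x ∂μ, x ∈ μ.support := hμ.fullySupported.measure_compl_support
    filter_upwards [h0] with x hx
    have h1 := SimpleFunc.tendsto_approxOn (f := fun x : M => x) measurable_id h₀
      (subset_closure (Or.inr hx) : x ∈ closure ({x₀} ∪ μ.support))
    have h2 := ((tendsto_const_nhds (x := x)).edist h1).ennrpow_const p
    rwa [edist_self, ENNReal.zero_rpow_of_pos hp0] at h2
  have := tendsto_lintegral_of_dominated_convergence (μ := μ) (f := fun _ => 0)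
    (fun x => edist x₀ x ^ p)
    (fun m => ((T m).measurable_bind (fun b x => edist x b ^ p) fun b =>
      (by fun_prop : Continuous fun x : M => edist x b).measurable.pow_const p))
    (fun m => Eventually.of_forall (hle m)) hx₀.ne hlim
  simpa using this

lemma integral_empiricalMeasure (n : ℕ) (x : ℕ → M) (φ : M → ℝ) :
    ∫ y, φ y ∂empiricalMeasure n x = (∑ i ∈ Finset.range n, φ (x i)) / n := by
  rw [empiricalMeasure, integral_smul_measure,
    integral_finsetSum_measure fun i _ => integrable_dirac (by simp)]
  simp [div_eq_inv_mul]

lemma integrable_empiricalMeasure {n : ℕ} (hn : 0 < n) (x : ℕ → M) (φ : M → ℝ) :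
    Integrable φ (empiricalMeasure n x) :=
  (integrable_finsetSum_measure.2 fun i _ => integrable_dirac (by simp)).smul_measure
    (by simp [hn.ne'])

/-- The strong law of large numbers for integrals against empirical measures. -/
lemma ae_tendsto_integral_empiricalMeasure {Ω : Type*} [MeasurableSpace Ω] {P : Measure Ω}
    [IsProbabilityMeasure P] {μ₀ : Measure M} {X : ℕ → Ω → M} (hX : ∀ i, Measurable (X i))
    (hindep : iIndepFun X P) (hlaw : ∀ i, P.map (X i) = μ₀) {φ : M → ℝ} (hφ : Measurable φ)
    (hint : Integrable φ μ₀) :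
    ∀ᵐ ω ∂P, Tendsto (fun n : ℕ => ∫ y, φ y ∂empiricalMeasure (n + 1) (fun i => X i ω)) atTop
      (𝓝 (∫ y, φ y ∂μ₀)) := by
  have h := strong_law_ae_real (μ := P) (fun i ω => φ (X i ω))
    ((hlaw 0 ▸ hint).comp_measurable (hX 0))
    (fun i j hij => (hindep.indepFun hij).comp hφ hφ)
    (fun i => (IdentDistrib.mk (hX i).aemeasurable (hX 0).aemeasurable
      (by rw [hlaw, hlaw])).comp hφ)
  filter_upwards [h] with ω hω
  rw [← hlaw 0, integral_map (hX 0).aemeasurable hφ.aestronglyMeasurable]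
  simp_rw [integral_empiricalMeasure]
  exact hω.comp (tendsto_add_atTop_nat 1)

end Barycentric

theorem corollary6p3 {M : Type*} [MetricSpace M] [CompleteSpace M]
    [MeasurableSpace M] [BorelSpace M]
    {Ω : Type*} [MeasurableSpace Ω] (P : Measure Ω) [IsProbabilityMeasure P]
    (p : ℝ) (hp : 1 ≤ p)
    (β : Barycentric.Pp p M → M) (hβ : Barycentric.IsContractiveBarycentric hp β)
    (μ₀ : Measure M) (hμ₀ : Barycentric.IsBdd μ₀)
    (X : ℕ → Ω → M) (hX : ∀ i, Measurable (X i))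
    (hindep : iIndepFun X P) (hlaw : ∀ i, P.map (X i) = μ₀) :
    ∀ᵐ ω ∂P, Tendsto
      (fun n : ℕ => β (Barycentric.empirical hp n.succ_pos (fun i => X i ω)))
      atTop (𝓝 (β ⟨μ₀, hμ₀.isPth hp⟩)) := by
  have hprob := hμ₀.fullySupported.prob
  have hp0 : 0 < p := by linarith
  obtain ⟨T, hTfin, hT⟩ := (hμ₀.isPth hp).exists_simpleFunc hp
  have hmeas : ∀ m, Measurable fun x => dist x (T m x) ^ p := fun m =>
    (T m).measurable_bind (fun b x => dist x b ^ p) fun b =>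
      (by fun_prop : Continuous fun x : M => dist x b).measurable.pow_const p
  have hedist : ∀ m x, ENNReal.ofReal (dist x (T m x) ^ p) = edist x (T m x) ^ p := fun m x => by
    rw [edist_dist, ENNReal.ofReal_rpow_of_nonneg dist_nonneg hp0.le]
  have hnn : ∀ m x, 0 ≤ dist x (T m x) ^ p := fun m x => by positivity
  have hint : ∀ m, Integrable (fun x => dist x (T m x) ^ p) μ₀ := fun m => by
    refine ⟨(hmeas m).aestronglyMeasurable, ?_⟩
    rw [hasFiniteIntegral_iff_ofReal (Eventually.of_forall (hnn m))]
    simp_rw [hedist]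
    exact (hTfin m).lt_top
  -- Countably many `m`, each with a finite range, leave a single null set, so `m` can be chosen
  -- after `ω`.
  have hcost : ∀ᵐ ω ∂P, ∀ m, Tendsto (fun n : ℕ => ∫ x, dist x (T m x) ^ p
      ∂Barycentric.empiricalMeasure (n + 1) (fun i => X i ω)) atTop
      (𝓝 (∫ x, dist x (T m x) ^ p ∂μ₀)) :=
    ae_all_iff.2 fun m =>
      Barycentric.ae_tendsto_integral_empiricalMeasure hX hindep hlaw (hmeas m) (hint m)
  have hmass : ∀ᵐ ω ∂P, ∀ m, ∀ y : (T m).range, Tendsto (fun n : ℕ =>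
      (Barycentric.empiricalMeasure (n + 1) (fun i => X i ω)).real (T m ⁻¹' {(y : M)})) atTop
      (𝓝 (μ₀.real (T m ⁻¹' {(y : M)}))) := by
    refine ae_all_iff.2 fun m => ae_all_iff.2 fun y => ?_
    have hs : MeasurableSet (T m ⁻¹' {(y : M)}) := (T m).measurableSet_fiber _
    have h := Barycentric.ae_tendsto_integral_empiricalMeasure hX hindep hlaw
      (measurable_one.indicator hs) ((integrable_const (1 : ℝ)).indicator hs)
    simpa only [integral_indicator_one hs] using h
  filter_upwards [hcost, hmass] with ω hω₁ hω₂
  have hA : ∀ m, Tendsto (fun n : ℕ => ∫⁻ x, edist x (T m x) ^ p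
      ∂Barycentric.empiricalMeasure (n + 1) (fun i => X i ω)) atTop
      (𝓝 (∫⁻ x, edist x (T m x) ^ p ∂μ₀)) := fun m => by
    have h := ENNReal.tendsto_ofReal (hω₁ m)
    simp_rw [← hedist]
    rw [ofReal_integral_eq_lintegral_ofReal (hint m) (Eventually.of_forall (hnn m))] at h
    refine h.congr fun n => ?_
    exact ofReal_integral_eq_lintegral_ofReal
      (Barycentric.integrable_empiricalMeasure n.succ_pos _ _) (Eventually.of_forall (hnn m))
  have hB : ∀ m, Tendsto (fun n : ℕ => (ENNReal.ofReal (1 - ∑ y : (T m).range,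
      min ((Barycentric.empiricalMeasure (n + 1) (fun i => X i ω)).real (T m ⁻¹' {(y : M)}))
        (μ₀.real (T m ⁻¹' {(y : M)}))) * Metric.ediam (Set.range (T m)) ^ p) ^ (1 / p)) atTop
      (𝓝 0) := fun m => by
    -- In the limit both arguments of each minimum agree, so the shared mass tends to 1.
    have h1 := (tendsto_const_nhds (x := (1 : ℝ))).sub (tendsto_finsetSum Finset.univ
      fun (y : (T m).range) _ => (hω₂ m y).min
        (tendsto_const_nhds (x := μ₀.real (T m ⁻¹' {(y : M)}))))
    simp only [min_self, Barycentric.sum_range_measureReal_preimage, sub_self] at h1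
    have hD : Metric.ediam (Set.range (T m)) ^ p ≠ ∞ :=
      ENNReal.rpow_ne_top_of_nonneg hp0.le
        (Metric.isBounded_iff_ediam_ne_top.1 (T m).finite_range.isBounded)
    have h2 := (ENNReal.Tendsto.mul_const (ENNReal.tendsto_ofReal h1)
      (Or.inr hD)).ennrpow_const (1 / p)
    simpa [hp0] using h2
  rw [tendsto_iff_edist_tendsto_0, ENNReal.tendsto_nhds_zero]
  intro ε hε
  -- For fixed `m`, this is the limit in `n` of the bound from `edist_le`; `m` is fixed first to
  -- make it less than `ε`.
  have hC : Tendsto (fun m => (∫⁻ x, edist x (T m x) ^ p ∂μ₀) ^ (1 / p) + 0 +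
      (∫⁻ x, edist x (T m x) ^ p ∂μ₀) ^ (1 / p)) atTop (𝓝 0) := by
    have h := hT.ennrpow_const (1 / p)
    simpa [hp0] using (h.add_const 0).add h
  obtain ⟨m, hm⟩ := (hC.eventually_lt_const hε).exists
  have hlim := ((((hA m).ennrpow_const (1 / p)).add (hB m)).add_const
    ((∫⁻ x, edist x (T m x) ^ p ∂μ₀) ^ (1 / p)))
  filter_upwards [hlim.eventually_lt_const hm] with n hn
  exact (hβ.edist_le _ _ (T m)).trans hn.le
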